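/- Let $(\mathcal M,g,A)$ be a smooth ($C^\infty$, Hausdorff, without boundary) Kähler manifold of real dimension $n$: $g$ is a smooth Riemannian metric with Levi-Civita connection $\overset{g}{\nabla}$, and $A$ is a smooth $(1,1)$-tensor field with $$A^2=-I,\qquad g(AX,AY)=g(X,Y),\qquad \overset{g}{\nabla}A=0.$$ Let $\pi$ be a smooth $1$-form on $\mathcal M$, and let $\overset{1}{\nabla}$ be the quarter-symmetric metric $A$-connection with generator $\pi$, that is, $$\overset{1}{\nabla}_XY=\overset{g}{\nabla}_XY-\pi(X)\,AY .$$ Let $$\overset{1}{R}(X,Y)Z=\overset{1}{\nabla}_X\overset{1}{\nabla}_YZ-\overset{1}{\nabla}_Y\overset{1}{\nabla}_XZ-\overset{1}{\nabla}_{[X,Y]}Z,\qquad \overset{1}{R}(X,Y,Z,W)=g(\overset{1}{R}(X,Y)Z,W)$$ be its curvature tensor (the curvature tensor of the first kind). A $(0,2)$-tensor $B$ is called hybrid if $B(AX,Y)=-B(X,AY)$ for all smooth vector fields $X,Y$; for $\overset{g}{\nabla}\pi$ this refers to $B(X,Y)=(\overset{g}{\nabla}_X\pi)(Y)=X(\pi(Y))-\pi(\overset{g}{\nabla}_XY)$.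 (1) If $\overset{g}{\nabla}\pi$ is hybrid, then for all smooth vector fields $X,Y,Z,W$ $$\overset{1}{R}(X,Y,AZ,AW)=\overset{1}{R}(AX,AY,Z,W),$$ $$\overset{1}{R}(X,AY,AZ,W)=\overset{1}{R}(AX,Y,Z,AW),$$ $$\overset{1}{R}(AX,AY,AZ,AW)=\overset{1}{R}(X,Y,Z,W).$$ (2) Without any hybridity assumption, for all smooth vector fields $X,Y,Z,W$ $$\overset{1}{R}(X,Y)AZ=A\,\overset{1}{R}(X,Y)Z,\qquad \overset{1}{R}(X,Y,Z,AW)=-\overset{1}{R}(X,Y,AZ,W).$$ -/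

import Mathlib

open Bundle Set
open scoped Manifold ContDiff

noncomputable section

namespace KahlerQS

section Basic

variable {n : ℕ} {M : Type*} [TopologicalSpace M] [ChartedSpace (EuclideanSpace ℝ (Fin n)) M]
  [IsManifold (𝓡 n) ∞ M]

/-- A smooth vector field. -/
def IsSmoothField (X : ∀ x : M, TangentSpace (𝓡 n) x) : Prop :=
  ContMDiff (𝓡 n) ((𝓡 n).prod 𝓘(ℝ, EuclideanSpace ℝ (Fin n))) ∞
    (fun x ↦ TotalSpace.mk' (EuclideanSpace ℝ (Fin n)) (E := (TangentSpace (𝓡 n) : M → Type _))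
      x (X x))

/-- A smooth `1`-form. -/
def IsSmoothOneForm (η : ∀ x : M, TangentSpace (𝓡 n) x →L[ℝ] ℝ) : Prop :=
  ContMDiff (𝓡 n) ((𝓡 n).prod 𝓘(ℝ, EuclideanSpace ℝ (Fin n) →L[ℝ] ℝ)) ∞
    (fun x ↦ TotalSpace.mk' (EuclideanSpace ℝ (Fin n) →L[ℝ] ℝ)
      (E := fun x : M ↦ (TangentSpace (𝓡 n) x →L[ℝ] ℝ)) x (η x))

/-- A smooth `(1,1)`-tensor field. -/
def IsSmoothEndo (A : ∀ x : M, TangentSpace (𝓡 n) x →L[ℝ] TangentSpace (𝓡 n) x) : Prop :=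
  ContMDiff (𝓡 n)
    ((𝓡 n).prod 𝓘(ℝ, EuclideanSpace ℝ (Fin n) →L[ℝ] EuclideanSpace ℝ (Fin n))) ∞
    (fun x ↦ TotalSpace.mk' (EuclideanSpace ℝ (Fin n) →L[ℝ] EuclideanSpace ℝ (Fin n))
      (E := fun x : M ↦ (TangentSpace (𝓡 n) x →L[ℝ] TangentSpace (𝓡 n) x)) x (A x))

/-- The vector field `A X`. -/
def endoApply (A : ∀ x : M, TangentSpace (𝓡 n) x →L[ℝ] TangentSpace (𝓡 n) x)
    (X : ∀ x : M, TangentSpace (𝓡 n) x) : ∀ x : M, TangentSpace (𝓡 n) x :=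
  fun x ↦ A x (X x)

/-- The vector field `∇_X Y` of a linear connection on the tangent bundle. -/
def nabla (cov : CovariantDerivative (𝓡 n) (EuclideanSpace ℝ (Fin n))
      (TangentSpace (𝓡 n) : M → Type _))
    (X Y : ∀ x : M, TangentSpace (𝓡 n) x) : ∀ x : M, TangentSpace (𝓡 n) x :=
  fun x ↦ cov Y x (X x)

/-- The curvature `R(X,Y)Z = ∇_X ∇_Y Z - ∇_Y ∇_X Z - ∇_[X,Y] Z` of a linear connection. -/
def curvature (cov : CovariantDerivative (𝓡 n) (EuclideanSpace ℝ (Fin n))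
      (TangentSpace (𝓡 n) : M → Type _))
    (X Y Z : ∀ x : M, TangentSpace (𝓡 n) x) : ∀ x : M, TangentSpace (𝓡 n) x :=
  fun x ↦ nabla cov X (nabla cov Y Z) x - nabla cov Y (nabla cov X Z) x
    - nabla cov (VectorField.mlieBracket (𝓡 n) X Y) Z x

/-- The covariant derivative `(∇_X η)(Y) = X(η(Y)) - η(∇_X Y)` of a `1`-form. -/
def nablaOneForm (cov : CovariantDerivative (𝓡 n) (EuclideanSpace ℝ (Fin n))
      (TangentSpace (𝓡 n) : M → Type _))
    (η : ∀ x : M, TangentSpace (𝓡 n) x →L[ℝ] ℝ)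
    (X Y : ∀ x : M, TangentSpace (𝓡 n) x) : M → ℝ :=
  fun x ↦ mvfderiv (𝓡 n) (fun y ↦ η y (Y y)) x (X x) - η x (nabla cov X Y x)

/-- The covariant derivative `(∇_X A)Y = ∇_X (A Y) - A (∇_X Y)` of a `(1,1)`-tensor field. -/
def nablaEndo (cov : CovariantDerivative (𝓡 n) (EuclideanSpace ℝ (Fin n))
      (TangentSpace (𝓡 n) : M → Type _))
    (A : ∀ x : M, TangentSpace (𝓡 n) x →L[ℝ] TangentSpace (𝓡 n) x)
    (X Y : ∀ x : M, TangentSpace (𝓡 n) x) : ∀ x : M, TangentSpace (𝓡 n) x :=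
  fun x ↦ nabla cov X (endoApply A Y) x - A x (nabla cov X Y x)

/-- A `(0,2)`-tensor `B`, given by its action on vector fields, is hybrid with respect to `A` if
`B(A X, Y) = - B(X, A Y)` for all smooth vector fields. -/
def IsHybrid (A : ∀ x : M, TangentSpace (𝓡 n) x →L[ℝ] TangentSpace (𝓡 n) x)
    (B : (∀ x : M, TangentSpace (𝓡 n) x) → (∀ x : M, TangentSpace (𝓡 n) x) → M → ℝ) : Prop :=
  ∀ X Y : ∀ x : M, TangentSpace (𝓡 n) x, IsSmoothField X → IsSmoothField Y →
    ∀ x : M, B (endoApply A X) Y x = - B X (endoApply A Y) x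

/-- The connection `∇_X Y - η(X) A Y` obtained from a linear connection `∇`, a `1`-form `η` and
a `(1,1)`-tensor field `A`. When `∇` is the Levi-Civita connection, this is the
quarter-symmetric connection with generator `η`. -/
def quarterSymmetric (cov : CovariantDerivative (𝓡 n) (EuclideanSpace ℝ (Fin n))
      (TangentSpace (𝓡 n) : M → Type _))
    (A : ∀ x : M, TangentSpace (𝓡 n) x →L[ℝ] TangentSpace (𝓡 n) x)
    (η : ∀ x : M, TangentSpace (𝓡 n) x →L[ℝ] ℝ) :
    CovariantDerivative (𝓡 n) (EuclideanSpace ℝ (Fin n)) (TangentSpace (𝓡 n) : M → Type _) where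
  toFun := fun Y x ↦ cov Y x - (η x).smulRight (A x (Y x))
  isCovariantDerivativeOnUniv :=
    { add := by
        intro σ σ' x hσ hσ' _
        ext v
        simp [cov.isCovariantDerivativeOnUniv.add hσ hσ', smul_add]
        abel
      leibniz := by
        intro σ f x hσ hf _
        ext v
        simp [cov.isCovariantDerivativeOnUniv.leibniz hσ hf, smul_sub, smul_smul, mul_comm]
        abel }

/-- The curvature tensor of the first kind `R¹(X,Y)Z`: the curvature of the quarter-symmetric
connection. -/
def curvatureFirst (cov : CovariantDerivative (𝓡 n) (EuclideanSpace ℝ (Fin n))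
      (TangentSpace (𝓡 n) : M → Type _))
    (A : ∀ x : M, TangentSpace (𝓡 n) x →L[ℝ] TangentSpace (𝓡 n) x)
    (η : ∀ x : M, TangentSpace (𝓡 n) x →L[ℝ] ℝ)
    (X Y Z : ∀ x : M, TangentSpace (𝓡 n) x) : ∀ x : M, TangentSpace (𝓡 n) x :=
  curvature (quarterSymmetric cov A η) X Y Z

end Basic

section Metric

variable {n : ℕ} {M : Type*} [TopologicalSpace M] [ChartedSpace (EuclideanSpace ℝ (Fin n)) M]
  [IsManifold (𝓡 n) ∞ M]
  [RiemannianBundle (fun x : M ↦ TangentSpace (𝓡 n) x)]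

/-- The function `g(X, Y)`. -/
def metric (X Y : ∀ x : M, TangentSpace (𝓡 n) x) : M → ℝ :=
  fun x ↦ inner ℝ (X x) (Y x)

/-- The `(0,4)` curvature tensor of the first kind `R¹(X,Y,Z,W) = g(R¹(X,Y)Z, W)`. -/
def curvatureFirst4 (cov : CovariantDerivative (𝓡 n) (EuclideanSpace ℝ (Fin n))
      (TangentSpace (𝓡 n) : M → Type _))
    (A : ∀ x : M, TangentSpace (𝓡 n) x →L[ℝ] TangentSpace (𝓡 n) x)
    (η : ∀ x : M, TangentSpace (𝓡 n) x →L[ℝ] ℝ)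
    (X Y Z W : ∀ x : M, TangentSpace (𝓡 n) x) : M → ℝ :=
  metric (curvatureFirst cov A η X Y Z) W

/-- An almost Hermitian structure on a Riemannian manifold: a smooth `(1,1)`-tensor field `A` with
`A² = -I` and `g(A u, A v) = g(u, v)`. -/
structure IsAlmostHermitian
    (A : ∀ x : M, TangentSpace (𝓡 n) x →L[ℝ] TangentSpace (𝓡 n) x) : Prop where
  smooth : IsSmoothEndo A
  sq : ∀ (x : M) (v : TangentSpace (𝓡 n) x), A x (A x v) = -v
  isometry : ∀ (x : M) (u v : TangentSpace (𝓡 n) x), inner ℝ (A x u) (A x v) = inner ℝ u v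

variable [IsContMDiffRiemannianBundle (𝓡 n) ∞ (EuclideanSpace ℝ (Fin n))
    (fun x : M ↦ TangentSpace (𝓡 n) x)]

set_option synthInstance.maxHeartbeats 200000 in
/-- The Levi-Civita connection: the smooth linear connection that is compatible with the metric
and torsion-free. (These conditions determine it on smooth vector fields.) -/
structure IsLeviCivita (cov : CovariantDerivative (𝓡 n) (EuclideanSpace ℝ (Fin n))
      (TangentSpace (𝓡 n) : M → Type _)) : Prop where
  smooth : CovariantDerivative.ContMDiffCovariantDerivative cov ∞
  metric : cov.IsMetricCompatible
  torsion : cov.torsion = 0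

/-- `(M, g, A)` is a Kähler manifold, `cov` being the Levi-Civita connection of `g`: the structure
is almost Hermitian and `∇A = 0`. -/
structure IsKahler (cov : CovariantDerivative (𝓡 n) (EuclideanSpace ℝ (Fin n))
      (TangentSpace (𝓡 n) : M → Type _))
    (A : ∀ x : M, TangentSpace (𝓡 n) x →L[ℝ] TangentSpace (𝓡 n) x) : Prop where
  leviCivita : IsLeviCivita cov
  almostHermitian : IsAlmostHermitian A
  parallel : ∀ X Y : ∀ x : M, TangentSpace (𝓡 n) x, IsSmoothField X → IsSmoothField Y →
    ∀ x : M, nablaEndo cov A X Y x = 0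

end Metric

end KahlerQS

end

open KahlerQS

/-! Write R for the Levi-Civita curvature and dη(X,Y) = (∇_X η)Y - (∇_Y η)X. Expanding the
quarter-symmetric connection with `∇A = 0` and zero torsion gives R¹(X,Y)Z = R(X,Y)Z - dη(X,Y) AZ
(`curvatureFirst_eq`). Since R(X,Y) commutes with `A`, so does R¹(X,Y); as `A` is a skew-adjoint
isometry, this settles part (2) and the invariance of R¹ under `A` in its last pair, with no
condition on η.

Part (1) also needs invariance in the first pair. For R this is inherited from the last pair through
the symmetry g(R(X,Y)Z,W) = g(R(Z,W)X,Y); for dη it is exactly what hybridity supplies. The pair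
symmetry is derived from the first Bianchi identity, which is the Jacobi identity for a torsion-free
connection, and from skewness in the last pair, which is metric compatibility combined with the
action of a bracket on functions as a commutator of derivations. -/

noncomputable section
namespace KahlerQS

open VectorField

/-! ### Smooth fields, and the Lie bracket as a commutator of derivations. -/

section Fields

variable {n : ℕ} {M : Type*} [TopologicalSpace M] [ChartedSpace (EuclideanSpace ℝ (Fin n)) M]
  [IsManifold (𝓡 n) ∞ M]
  {X Y Z : ∀ x : M, TangentSpace (𝓡 n) x}

lemma IsSmoothField.mdifferentiableAt (hX : IsSmoothField X) (x : M) : MDifferentiableAt (𝓡 n) ((𝓡 n).prod 𝓘(ℝ, EuclideanSpace ℝ (Fin n)))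
      (fun y ↦ TotalSpace.mk' (EuclideanSpace ℝ (Fin n)) (E := (TangentSpace (𝓡 n) : M → Type _))
        y (X y)) x :=
  (hX x).mdifferentiableAt (by simp)

lemma IsSmoothField.smul {f : M → ℝ} (hf : ContMDiff (𝓡 n) 𝓘(ℝ, ℝ) ∞ f) (hX : IsSmoothField X) :
    IsSmoothField (f • X) :=
  ContMDiff.smul_section hf hX

lemma IsSmoothField.sub (hX : IsSmoothField X) (hY : IsSmoothField Y) : IsSmoothField (X - Y) :=
  ContMDiff.sub_section hX hY

lemma IsSmoothField.endoApply {A : ∀ x : M, TangentSpace (𝓡 n) x →L[ℝ] TangentSpace (𝓡 n) x}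
    (hA : IsSmoothEndo A) (hX : IsSmoothField X) : IsSmoothField (endoApply A X) :=
  ContMDiff.clm_bundle_apply hA hX

lemma IsSmoothField.nabla {cov : CovariantDerivative (𝓡 n) (EuclideanSpace ℝ (Fin n))
      (TangentSpace (𝓡 n) : M → Type _)}
    (hcov : CovariantDerivative.ContMDiffCovariantDerivative cov ∞)
    (hX : IsSmoothField X) (hY : IsSmoothField Y) : IsSmoothField (nabla cov X Y) := by
  have h := hcov.contMDiff.contMDiff (σ := Y) (ContMDiff.contMDiffOn hY)
  exact ContMDiff.clm_bundle_apply (contMDiffOn_univ.1 h) hX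

lemma IsSmoothOneForm.contMDiff_apply {η : ∀ x : M, TangentSpace (𝓡 n) x →L[ℝ] ℝ}
    (hη : IsSmoothOneForm η) (hX : IsSmoothField X) : ContMDiff (𝓡 n) 𝓘(ℝ, ℝ) ∞ (fun x ↦ η x (X x)) := by
  -- The function is viewed as a section of the trivial line bundle, so that smoothness of bundle
  -- evaluation applies.
  have h : ContMDiff (𝓡 n) ((𝓡 n).prod 𝓘(ℝ, ℝ)) ∞
      (fun x : M ↦ TotalSpace.mk' ℝ (E := Bundle.Trivial M ℝ) x (η x (X x))) := by
    refine ContMDiff.clm_bundle_apply (E₂ := Bundle.Trivial M ℝ) ?_ hX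
    exact hη
  intro x
  have hx := h x
  simp only [contMDiffAt_totalSpace] at hx
  exact hx.2

lemma IsSmoothField.mlieBracket (hX : IsSmoothField X) (hY : IsSmoothField Y) :
    IsSmoothField (mlieBracket (𝓡 n) X Y) := by
  have : IsManifold (𝓡 n) (minSmoothness ℝ 2) M := by
    simpa using! (inferInstance : IsManifold (𝓡 n) 2 M)
  have : IsManifold (𝓡 n) (((⊤ : ℕ∞) : ℕ∞ω) + 1) M := by simpa using! ‹IsManifold (𝓡 n) ∞ M›
  exact ContDiff.mlieBracket_vectorField (n := ⊤) (m := ⊤) hX hY (by simp)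

lemma mlieBracket_jacobi (hX : IsSmoothField X) (hY : IsSmoothField Y) (hZ : IsSmoothField Z) :
    mlieBracket (𝓡 n) X (mlieBracket (𝓡 n) Y Z) =
      mlieBracket (𝓡 n) (mlieBracket (𝓡 n) X Y) Z +
        mlieBracket (𝓡 n) Y (mlieBracket (𝓡 n) X Z) := by
  have : IsManifold (𝓡 n) (minSmoothness ℝ 3) M := by
    simpa using! (inferInstance : IsManifold (𝓡 n) 3 M)
  exact leibniz_identity_mlieBracket (ContMDiff.of_le hX (by simpa using ENat.LEInfty.out))
    (ContMDiff.of_le hY (by simpa using ENat.LEInfty.out)) (ContMDiff.of_le hZ (by simpa using ENat.LEInfty.out))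

/-- The bracket acts on functions as the commutator of derivations, tested against a field. -/
lemma mvfderiv_mlieBracket_smul {f : M → ℝ} (hf : ContMDiff (𝓡 n) 𝓘(ℝ, ℝ) ∞ f)
    (hX : IsSmoothField X) (hY : IsSmoothField Y) (hZ : IsSmoothField Z)
    (hXf : ContMDiff (𝓡 n) 𝓘(ℝ, ℝ) ∞ (fun x ↦ mvfderiv (𝓡 n) f x (X x)))
    (hYf : ContMDiff (𝓡 n) 𝓘(ℝ, ℝ) ∞ (fun x ↦ mvfderiv (𝓡 n) f x (Y x))) (x : M) :
    (mvfderiv (𝓡 n) f x (mlieBracket (𝓡 n) X Y x)) • Z x =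
      (mvfderiv (𝓡 n) (fun y ↦ mvfderiv (𝓡 n) f y (Y y)) x (X x) -
        mvfderiv (𝓡 n) (fun y ↦ mvfderiv (𝓡 n) f y (X y)) x (Y x)) • Z x := by
  have hf' (y : M) : MDifferentiableAt (𝓡 n) 𝓘(ℝ, ℝ) f y := (hf y).mdifferentiableAt (by simp)
  have key : ∀ V : ∀ x : M, TangentSpace (𝓡 n) x,
      mlieBracket (𝓡 n) V (f • Z) =
        (fun y ↦ mvfderiv (𝓡 n) f y (V y)) • Z + f • mlieBracket (𝓡 n) V Z := by
    intro V
    ext1 y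
    exact mlieBracket_smul_right (hf' y) (hZ.mdifferentiableAt y)
  have h2 : ∀ {U V : ∀ x : M, TangentSpace (𝓡 n) x}, IsSmoothField V →
      ContMDiff (𝓡 n) 𝓘(ℝ, ℝ) ∞ (fun x ↦ mvfderiv (𝓡 n) f x (V x)) →
      mlieBracket (𝓡 n) U (mlieBracket (𝓡 n) V (f • Z)) x =
        mvfderiv (𝓡 n) (fun y ↦ mvfderiv (𝓡 n) f y (V y)) x (U x) • Z x +
        mvfderiv (𝓡 n) f x (V x) • mlieBracket (𝓡 n) U Z x +
        (mvfderiv (𝓡 n) f x (U x) • mlieBracket (𝓡 n) V Z x +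
         f x • mlieBracket (𝓡 n) U (mlieBracket (𝓡 n) V Z) x) := by
    intro U V hV hVf
    rw [key V, mlieBracket_add_right ((hZ.smul hVf).mdifferentiableAt x)
      (((hV.mlieBracket hZ).smul hf).mdifferentiableAt x),
      mlieBracket_smul_right ((hVf x).mdifferentiableAt (by simp)) (hZ.mdifferentiableAt x),
      mlieBracket_smul_right (hf' x) ((hV.mlieBracket hZ).mdifferentiableAt x)]
  -- In the Jacobi identity for `X`, `Y`, `f • Z`, the terms with one derivative of `f` cancel in
  -- pairs and those with none cancel by Jacobi for `Z`; only second derivatives and the derivative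
  -- along the bracket remain.
  have J := congrFun (mlieBracket_jacobi hX hY (hZ.smul hf)) x
  rw [Pi.add_apply, h2 hY hYf, h2 hX hXf, key (mlieBracket (𝓡 n) X Y),
    mlieBracket_jacobi hX hY hZ] at J
  simp only [Pi.add_apply, Pi.smul_apply', smul_add] at J
  rw [sub_smul, eq_sub_iff_add_eq, ← sub_eq_zero]
  rw [← sub_eq_zero] at J
  rw [← neg_eq_zero, ← J]
  abel

/-- The test field can be `X` or `Y` itself, whichever is nonzero at `x`, so no auxiliary field has
to be constructed. If both vanish at `x`, so does their bracket, and both sides are zero. -/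
lemma mvfderiv_mlieBracket {f : M → ℝ} (hf : ContMDiff (𝓡 n) 𝓘(ℝ, ℝ) ∞ f)
    (hX : IsSmoothField X) (hY : IsSmoothField Y)
    (hXf : ContMDiff (𝓡 n) 𝓘(ℝ, ℝ) ∞ (fun x ↦ mvfderiv (𝓡 n) f x (X x)))
    (hYf : ContMDiff (𝓡 n) 𝓘(ℝ, ℝ) ∞ (fun x ↦ mvfderiv (𝓡 n) f x (Y x))) (x : M) :
    mvfderiv (𝓡 n) f x (mlieBracket (𝓡 n) X Y x) =
      mvfderiv (𝓡 n) (fun y ↦ mvfderiv (𝓡 n) f y (Y y)) x (X x) -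
        mvfderiv (𝓡 n) (fun y ↦ mvfderiv (𝓡 n) f y (X y)) x (Y x) := by
  by_cases h1 : X x = 0
  · by_cases h2 : Y x = 0
    · have : mlieBracket (𝓡 n) X Y x = 0 := by
        rw [← mlieBracketWithin_univ]
        exact mlieBracketWithin_eq_zero_of_eq_zero h1 h2
      simp [h1, h2, this]
    · exact smul_left_injective ℝ h2 (mvfderiv_mlieBracket_smul hf hX hY hY hXf hYf x)
  · exact smul_left_injective ℝ h1 (mvfderiv_mlieBracket_smul hf hX hY hX hXf hYf x)

end Fields

/-! ### Linear connections and the first Bianchi identity. -/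

section Connection

variable {n : ℕ} {M : Type*} [TopologicalSpace M] [ChartedSpace (EuclideanSpace ℝ (Fin n)) M]
  [IsManifold (𝓡 n) ∞ M]
  {cov : CovariantDerivative (𝓡 n) (EuclideanSpace ℝ (Fin n)) (TangentSpace (𝓡 n) : M → Type _)}
  {X X' Y Y' Z : ∀ x : M, TangentSpace (𝓡 n) x}

lemma nabla_add_right (hY : IsSmoothField Y) (hY' : IsSmoothField Y') :
    nabla cov X (Y + Y') = nabla cov X Y + nabla cov X Y' := by
  ext1 x
  simpa using! congr($(cov.isCovariantDerivativeOnUniv.add (hY.mdifferentiableAt x)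
    (hY'.mdifferentiableAt x)) (X x))

lemma nabla_smul_right {f : M → ℝ} (hf : ContMDiff (𝓡 n) 𝓘(ℝ, ℝ) ∞ f) (hY : IsSmoothField Y) :
    nabla cov X (f • Y) =
      f • nabla cov X Y + (fun x ↦ mvfderiv (𝓡 n) f x (X x)) • Y := by
  ext1 x
  simpa using! congr($(cov.isCovariantDerivativeOnUniv.leibniz (hY.mdifferentiableAt x)
    ((hf x).mdifferentiableAt (by simp))) (X x))

lemma nabla_sub_right (hY : IsSmoothField Y) (hY' : IsSmoothField Y') :
    nabla cov X (Y - Y') = nabla cov X Y - nabla cov X Y' := by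
  rw [eq_sub_iff_add_eq, ← nabla_add_right (hY.sub hY') hY', sub_add_cancel]

lemma nabla_neg_right (hY : IsSmoothField Y) : nabla cov X (-Y) = -nabla cov X Y := by
  have h := nabla_sub_right (cov := cov) (X := X) (hY.sub hY) hY
  rw [nabla_sub_right hY hY] at h
  simpa using h

lemma nabla_neg_left : nabla cov (-X) Y = -nabla cov X Y := by
  ext1 x
  simp [nabla]

lemma curvature_swap : curvature cov Y X Z = -curvature cov X Y Z := by
  ext1 x
  have : mlieBracket (𝓡 n) Y X = -mlieBracket (𝓡 n) X Y := mlieBracket_swap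
  simp [curvature, nabla, this]
  abel

/-- The first Bianchi identity. -/
lemma curvature_cyclic (hcov : CovariantDerivative.ContMDiffCovariantDerivative cov ∞)
    (htor : ∀ {X Y : ∀ x : M, TangentSpace (𝓡 n) x}, IsSmoothField X → IsSmoothField Y →
      nabla cov X Y - nabla cov Y X = mlieBracket (𝓡 n) X Y)
    (hX : IsSmoothField X) (hY : IsSmoothField Y) (hZ : IsSmoothField Z) :
    curvature cov X Y Z + curvature cov Y Z X + curvature cov Z X Y = 0 := by
  -- Zero torsion, used for both brackets, turns each double bracket of the Jacobi identity into
  -- covariant derivatives.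
  have key : ∀ {U V W : ∀ x : M, TangentSpace (𝓡 n) x}, IsSmoothField U → IsSmoothField V →
      IsSmoothField W → mlieBracket (𝓡 n) U (mlieBracket (𝓡 n) V W) =
        nabla cov U (nabla cov V W) - nabla cov U (nabla cov W V) -
          nabla cov (mlieBracket (𝓡 n) V W) U := by
    intro U V W hU hV hW
    rw [← htor hU (hV.mlieBracket hW), ← nabla_sub_right (hV.nabla hcov hW) (hW.nabla hcov hV),
      htor hV hW]
  have J := mlieBracket_jacobi hX hY hZ
  rw [mlieBracket_swap (V := mlieBracket (𝓡 n) X Y), key hX hY hZ, key hZ hX hY, key hY hX hZ,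
    mlieBracket_swap (V := X) (W := Z), nabla_neg_left, ← sub_eq_zero] at J
  ext1 x
  rw [← J]
  simp only [curvature, Pi.add_apply, Pi.sub_apply, Pi.neg_apply]
  abel

end Connection

/-! ### Curvature of the quarter-symmetric connection. -/

section QuarterSymmetric

variable {n : ℕ} {M : Type*} [TopologicalSpace M] [ChartedSpace (EuclideanSpace ℝ (Fin n)) M]
  [IsManifold (𝓡 n) ∞ M]
  {cov : CovariantDerivative (𝓡 n) (EuclideanSpace ℝ (Fin n)) (TangentSpace (𝓡 n) : M → Type _)}
  {A : ∀ x : M, TangentSpace (𝓡 n) x →L[ℝ] TangentSpace (𝓡 n) x}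
  {η : ∀ x : M, TangentSpace (𝓡 n) x →L[ℝ] ℝ}
  {X Y Z : ∀ x : M, TangentSpace (𝓡 n) x}

lemma nabla_quarterSymmetric :
    nabla (quarterSymmetric cov A η) X Y =
      nabla cov X Y - (fun x ↦ η x (X x)) • endoApply A Y := by
  ext1 x
  simp [nabla, quarterSymmetric, endoApply]

lemma nabla_endoApply
    (hpar : ∀ X Y : ∀ x : M, TangentSpace (𝓡 n) x, IsSmoothField X → IsSmoothField Y →
      ∀ x : M, nablaEndo cov A X Y x = 0)
    (hX : IsSmoothField X) (hY : IsSmoothField Y) :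
    nabla cov X (endoApply A Y) = endoApply A (nabla cov X Y) := by
  ext1 x
  exact sub_eq_zero.1 (hpar X Y hX hY x)

lemma curvature_endoApply (hcov : CovariantDerivative.ContMDiffCovariantDerivative cov ∞)
    (hpar : ∀ X Y : ∀ x : M, TangentSpace (𝓡 n) x, IsSmoothField X → IsSmoothField Y →
      ∀ x : M, nablaEndo cov A X Y x = 0)
    (hX : IsSmoothField X) (hY : IsSmoothField Y) (hZ : IsSmoothField Z) :
    curvature cov X Y (endoApply A Z) = endoApply A (curvature cov X Y Z) := by
  ext1 x
  simp only [curvature, nabla_endoApply hpar hX hZ, nabla_endoApply hpar hY hZ,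
    nabla_endoApply hpar hX (hY.nabla hcov hZ), nabla_endoApply hpar hY (hX.nabla hcov hZ),
    nabla_endoApply hpar (hX.mlieBracket hY) hZ]
  simp [endoApply, curvature]

/-- For a torsion-free connection with `∇A = 0`, the curvature tensor of the first kind is
`R(X,Y)Z - dη(X,Y) AZ`. -/
lemma curvatureFirst_eq (hcov : CovariantDerivative.ContMDiffCovariantDerivative cov ∞)
    (htor : ∀ {X Y : ∀ x : M, TangentSpace (𝓡 n) x}, IsSmoothField X → IsSmoothField Y →
      nabla cov X Y - nabla cov Y X = mlieBracket (𝓡 n) X Y)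
    (hA : IsSmoothEndo A)
    (hpar : ∀ X Y : ∀ x : M, TangentSpace (𝓡 n) x, IsSmoothField X → IsSmoothField Y →
      ∀ x : M, nablaEndo cov A X Y x = 0)
    (hη : IsSmoothOneForm η)
    (hX : IsSmoothField X) (hY : IsSmoothField Y) (hZ : IsSmoothField Z) (x : M) :
    curvatureFirst cov A η X Y Z x = curvature cov X Y Z x -
      (nablaOneForm cov η X Y x - nablaOneForm cov η Y X x) • A x (Z x) := by
  -- The terms in `A (∇Z)` and in `A (A Z)` are symmetric in `U`, `V` and drop out on
  -- antisymmetrising; only the derivatives of `η` survive.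
  have key : ∀ {U V : ∀ x : M, TangentSpace (𝓡 n) x}, IsSmoothField U → IsSmoothField V →
      nabla (quarterSymmetric cov A η) U (nabla (quarterSymmetric cov A η) V Z) x =
        nabla cov U (nabla cov V Z) x - (η x (V x) • A x (nabla cov U Z x) +
          mvfderiv (𝓡 n) (fun y ↦ η y (V y)) x (U x) • A x (Z x)) -
        η x (U x) • (A x (nabla cov V Z x) - η x (V x) • A x (A x (Z x))) := by
    intro U V hU hV
    have hf := hη.contMDiff_apply hV
    have hAZ := hZ.endoApply hA
    rw [nabla_quarterSymmetric, nabla_quarterSymmetric,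
      nabla_sub_right (hV.nabla hcov hZ) (hAZ.smul hf), nabla_smul_right hf hAZ,
      nabla_endoApply hpar hU hZ]
    simp [endoApply]
  have hbr : η x (mlieBracket (𝓡 n) X Y x) =
      η x (nabla cov X Y x) - η x (nabla cov Y X x) := by
    rw [← htor hX hY, Pi.sub_apply, map_sub]
  rw [curvatureFirst, curvature, key hX hY, key hY hX, nabla_quarterSymmetric]
  simp only [curvature, nablaOneForm, Pi.sub_apply, Pi.smul_apply', endoApply, hbr]
  module

end QuarterSymmetric

/-! ### Pointwise algebra of `A`, and hybrid `∇η`. -/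

section AlmostHermitian

variable {n : ℕ} {M : Type*} [TopologicalSpace M] [ChartedSpace (EuclideanSpace ℝ (Fin n)) M]
  [IsManifold (𝓡 n) ∞ M]
  [RiemannianBundle (fun x : M ↦ TangentSpace (𝓡 n) x)]
  {A : ∀ x : M, TangentSpace (𝓡 n) x →L[ℝ] TangentSpace (𝓡 n) x}
  {cov : CovariantDerivative (𝓡 n) (EuclideanSpace ℝ (Fin n)) (TangentSpace (𝓡 n) : M → Type _)}
  {η : ∀ x : M, TangentSpace (𝓡 n) x →L[ℝ] ℝ}
  {X Y : ∀ x : M, TangentSpace (𝓡 n) x}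

lemma IsAlmostHermitian.endoApply_endoApply (h : IsAlmostHermitian A) :
    endoApply A (endoApply A X) = -X := by
  ext1 x
  exact h.sq x (X x)

lemma IsAlmostHermitian.inner_endo_right (h : IsAlmostHermitian A) (x : M)
    (u v : TangentSpace (𝓡 n) x) : inner ℝ u (A x v) = -inner ℝ (A x u) v := by
  rw [← h.isometry x u (A x v), h.sq]
  exact inner_neg_right _ _

/-- Hybridity moves the first `A` across with a minus sign, and `A² = -I` supplies a second one. -/
lemma IsAlmostHermitian.nablaOneForm_endoApply (h : IsAlmostHermitian A)
    (hyb : IsHybrid A (nablaOneForm cov η)) (hX : IsSmoothField X) (hY : IsSmoothField Y) (x : M) :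
    nablaOneForm cov η (endoApply A X) (endoApply A Y) x = nablaOneForm cov η X Y x := by
  rw [hyb X (endoApply A Y) hX (hY.endoApply h.smooth), h.endoApply_endoApply]
  have hneg : (fun y ↦ η y ((-Y) y)) = -fun y ↦ η y (Y y) := by
    ext1 y
    simp
  rw [nablaOneForm, nabla_neg_right hY, hneg, mvfderiv_neg]
  simp [nablaOneForm]
  ring

end AlmostHermitian

/-! ### Symmetries of the Levi-Civita curvature and of R¹. -/

section Riemannian

variable {n : ℕ} {M : Type*} [TopologicalSpace M] [ChartedSpace (EuclideanSpace ℝ (Fin n)) M]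
  [IsManifold (𝓡 n) ∞ M]
  [RiemannianBundle (fun x : M ↦ TangentSpace (𝓡 n) x)]
  [IsContMDiffRiemannianBundle (𝓡 n) ∞ (EuclideanSpace ℝ (Fin n))
    (fun x : M ↦ TangentSpace (𝓡 n) x)]
  {cov : CovariantDerivative (𝓡 n) (EuclideanSpace ℝ (Fin n)) (TangentSpace (𝓡 n) : M → Type _)}
  {A : ∀ x : M, TangentSpace (𝓡 n) x →L[ℝ] TangentSpace (𝓡 n) x}
  {η : ∀ x : M, TangentSpace (𝓡 n) x →L[ℝ] ℝ}
  {X Y Z W : ∀ x : M, TangentSpace (𝓡 n) x}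

lemma contMDiff_metric (hX : IsSmoothField X) (hY : IsSmoothField Y) :
    ContMDiff (𝓡 n) 𝓘(ℝ, ℝ) ∞ (metric X Y) :=
  ContMDiff.inner_bundle (b := fun x : M ↦ x) hX hY

lemma IsLeviCivita.nabla_sub_nabla (h : IsLeviCivita cov)
    (hX : IsSmoothField X) (hY : IsSmoothField Y) :
    nabla cov X Y - nabla cov Y X = mlieBracket (𝓡 n) X Y := by
  ext1 x
  exact cov.torsion_eq_zero_iff.1 h.torsion (hX.mdifferentiableAt x) (hY.mdifferentiableAt x)

set_option synthInstance.maxHeartbeats 200000 in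
lemma IsLeviCivita.mvfderiv_metric (h : IsLeviCivita cov)
    (hY : IsSmoothField Y) (hZ : IsSmoothField Z) :
    (fun x ↦ mvfderiv (𝓡 n) (KahlerQS.metric Y Z) x (X x)) =
      KahlerQS.metric (nabla cov X Y) Z + KahlerQS.metric Y (nabla cov X Z) := by
  ext1 x
  exact h.metric.mvfderiv_inner_eq X (hY.mdifferentiableAt x) (hZ.mdifferentiableAt x)

/-- The bracket acts on the function g(Z,W) as a commutator of derivations. Expanding by metric
compatibility, the mixed products of first derivatives cancel, leaving g(R(X,Y)Z,W) + g(Z,R(X,Y)W) =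
0. -/
lemma IsLeviCivita.metric_curvature_skew (h : IsLeviCivita cov)
    (hX : IsSmoothField X) (hY : IsSmoothField Y) (hZ : IsSmoothField Z) (hW : IsSmoothField W)
    (x : M) :
    KahlerQS.metric (curvature cov X Y Z) W x = -KahlerQS.metric (curvature cov X Y W) Z x := by
  have hs : ∀ {U V : ∀ x : M, TangentSpace (𝓡 n) x}, IsSmoothField U → IsSmoothField V →
      IsSmoothField (nabla cov U V) := fun hU hV ↦ hU.nabla h.smooth hV
  have hsm : ∀ {U : ∀ x : M, TangentSpace (𝓡 n) x}, IsSmoothField U →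
      ContMDiff (𝓡 n) 𝓘(ℝ, ℝ) ∞ (fun x ↦ mvfderiv (𝓡 n) (KahlerQS.metric Z W) x (U x)) := by
    intro U hU
    rw [h.mvfderiv_metric hZ hW]
    exact (contMDiff_metric (hs hU hZ) hW).add (contMDiff_metric hZ (hs hU hW))
  have key : ∀ {U V : ∀ x : M, TangentSpace (𝓡 n) x}, IsSmoothField U → IsSmoothField V →
      mvfderiv (𝓡 n) (fun y ↦ mvfderiv (𝓡 n) (KahlerQS.metric Z W) y (V y)) x (U x) =
        KahlerQS.metric (nabla cov U (nabla cov V Z)) W x + KahlerQS.metric (nabla cov V Z) (nabla cov U W) x +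
        (KahlerQS.metric (nabla cov U Z) (nabla cov V W) x + KahlerQS.metric Z (nabla cov U (nabla cov V W)) x) := by
    intro U V hU hV
    have h1 := contMDiff_metric (hs hV hZ) hW
    have h2 := contMDiff_metric hZ (hs hV hW)
    rw [h.mvfderiv_metric hZ hW, mvfderiv_add ((h1 x).mdifferentiableAt (by simp))
      ((h2 x).mdifferentiableAt (by simp)), add_apply]
    have e1 := congrFun (h.mvfderiv_metric (X := U) (hs hV hZ) hW) x
    have e2 := congrFun (h.mvfderiv_metric (X := U) hZ (hs hV hW)) x
    simp only [Pi.add_apply] at e1 e2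
    rw [e1, e2]
  have hbr := mvfderiv_mlieBracket (contMDiff_metric hZ hW) hX hY (hsm hX) (hsm hY) x
  have hb := congrFun (h.mvfderiv_metric (X := mlieBracket (𝓡 n) X Y) hZ hW) x
  simp only [Pi.add_apply] at hb
  rw [hb, key hX hY, key hY hX] at hbr
  simp only [KahlerQS.metric, curvature, inner_sub_left] at hbr ⊢
  simp only [real_inner_comm (Z x)] at hbr ⊢
  linarith

lemma IsLeviCivita.metric_curvature_pair (h : IsLeviCivita cov)
    (hX : IsSmoothField X) (hY : IsSmoothField Y) (hZ : IsSmoothField Z) (hW : IsSmoothField W)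
    (x : M) :
    KahlerQS.metric (curvature cov X Y Z) W x = KahlerQS.metric (curvature cov Z W X) Y x := by
  have bianchi : ∀ {U V S T : ∀ x : M, TangentSpace (𝓡 n) x}, IsSmoothField U →
      IsSmoothField V → IsSmoothField S → KahlerQS.metric (curvature cov U V S) T x +
        KahlerQS.metric (curvature cov V S U) T x + KahlerQS.metric (curvature cov S U V) T x = 0 := by
    intro U V S T hU hV hS
    have e := congrFun (curvature_cyclic h.smooth h.nabla_sub_nabla hU hV hS) x
    have e' := congr(inner ℝ $e (T x))
    simpa [inner_add_left, KahlerQS.metric] using! e'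
  have swap : ∀ U V S T : ∀ x : M, TangentSpace (𝓡 n) x,
      KahlerQS.metric (curvature cov U V S) T x = -KahlerQS.metric (curvature cov V U S) T x := by
    intro U V S T
    rw [curvature_swap (X := V) (Y := U)]
    simp [KahlerQS.metric]
  -- The classical octahedron argument: four Bianchi identities, each with a different field as the
  -- test field, combined after skewness in each pair identifies their terms.
  have b1 := bianchi (T := W) hX hY hZ
  have b2 := bianchi (T := X) hY hZ hW
  have b3 := bianchi (T := Y) hZ hW hX
  have b4 := bianchi (T := Z) hW hX hY
  have s1 := h.metric_curvature_skew hX hY hZ hW x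
  have s2 := h.metric_curvature_skew hY hZ hX hW x
  have s3 := h.metric_curvature_skew hZ hX hY hW x
  have s4 := h.metric_curvature_skew hZ hW hX hY x
  have s5 := h.metric_curvature_skew hW hY hZ hX x
  have s6 := h.metric_curvature_skew hW hX hZ hY x
  have t1 := swap X Z Y W
  have t2 := swap X W Y Z
  have t3 := swap Y W X Z
  have t4 := swap Y W Z X
  have t5 := swap Z X W Y
  have t6 := swap X W Z Y
  linarith

lemma IsKahler.metric_curvature_endoApply (h : IsKahler cov A)
    (hX : IsSmoothField X) (hY : IsSmoothField Y) (hZ : IsSmoothField Z) (x : M) :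
    metric (curvature cov X Y (endoApply A Z)) (endoApply A W) x =
      metric (curvature cov X Y Z) W x := by
  rw [curvature_endoApply h.leviCivita.smooth h.parallel hX hY hZ]
  exact h.almostHermitian.isometry x _ _

/-- Pair symmetry carries both copies of `A` to the last pair, where they cancel, and then carries
the fields back. -/
lemma IsKahler.metric_curvature_endoApply_left (h : IsKahler cov A)
    (hX : IsSmoothField X) (hY : IsSmoothField Y) (hZ : IsSmoothField Z) (hW : IsSmoothField W)
    (x : M) :
    metric (curvature cov (endoApply A X) (endoApply A Y) Z) W x =
      metric (curvature cov X Y Z) W x := by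
  have hA := h.almostHermitian.smooth
  rw [h.leviCivita.metric_curvature_pair (hX.endoApply hA) (hY.endoApply hA) hZ hW,
    h.metric_curvature_endoApply hZ hW hX, h.leviCivita.metric_curvature_pair hX hY hZ hW]

lemma IsKahler.curvatureFirst4_eq (h : IsKahler cov A) (hη : IsSmoothOneForm η)
    (hX : IsSmoothField X) (hY : IsSmoothField Y) (hZ : IsSmoothField Z) (x : M) :
    curvatureFirst4 cov A η X Y Z W x = metric (curvature cov X Y Z) W x -
      (nablaOneForm cov η X Y x - nablaOneForm cov η Y X x) * inner ℝ (A x (Z x)) (W x) := by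
  rw [curvatureFirst4, metric, curvatureFirst_eq h.leviCivita.smooth h.leviCivita.nabla_sub_nabla
    h.almostHermitian.smooth h.parallel hη hX hY hZ, inner_sub_left, real_inner_smul_left]
  rfl

lemma IsKahler.curvatureFirst_endoApply (h : IsKahler cov A) (hη : IsSmoothOneForm η)
    (hX : IsSmoothField X) (hY : IsSmoothField Y) (hZ : IsSmoothField Z) :
    curvatureFirst cov A η X Y (endoApply A Z) = endoApply A (curvatureFirst cov A η X Y Z) := by
  have hL := h.leviCivita
  have hA := h.almostHermitian.smooth
  ext1 x
  rw [curvatureFirst_eq hL.smooth hL.nabla_sub_nabla hA h.parallel hη hX hY (hZ.endoApply hA),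
    curvature_endoApply hL.smooth h.parallel hX hY hZ]
  simp only [endoApply, curvatureFirst_eq hL.smooth hL.nabla_sub_nabla hA h.parallel hη hX hY hZ,
    map_sub, map_smul]

lemma IsKahler.curvatureFirst4_endoApply_right (h : IsKahler cov A) (hη : IsSmoothOneForm η)
    (hX : IsSmoothField X) (hY : IsSmoothField Y) (hZ : IsSmoothField Z) :
    curvatureFirst4 cov A η X Y Z (endoApply A W) =
      -curvatureFirst4 cov A η X Y (endoApply A Z) W := by
  rw [curvatureFirst4, curvatureFirst4, h.curvatureFirst_endoApply hη hX hY hZ]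
  ext1 x
  exact h.almostHermitian.inner_endo_right x _ _

/-- Hybridity of `∇η` makes the curvature of the first kind `A`-invariant in its first pair. -/
lemma IsKahler.curvatureFirst4_endoApply_left (h : IsKahler cov A) (hη : IsSmoothOneForm η)
    (hyb : IsHybrid A (nablaOneForm cov η))
    (hX : IsSmoothField X) (hY : IsSmoothField Y) (hZ : IsSmoothField Z) (hW : IsSmoothField W) :
    curvatureFirst4 cov A η (endoApply A X) (endoApply A Y) Z W =
      curvatureFirst4 cov A η X Y Z W := by
  have hH := h.almostHermitian
  ext1 x
  rw [h.curvatureFirst4_eq hη (hX.endoApply hH.smooth) (hY.endoApply hH.smooth) hZ,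
    h.curvatureFirst4_eq hη hX hY hZ, h.metric_curvature_endoApply_left hX hY hZ hW,
    hH.nablaOneForm_endoApply hyb hX hY, hH.nablaOneForm_endoApply hyb hY hX]

lemma IsKahler.curvatureFirst4_endoApply_endoApply (h : IsKahler cov A) (hη : IsSmoothOneForm η)
    (hX : IsSmoothField X) (hY : IsSmoothField Y) (hZ : IsSmoothField Z) :
    curvatureFirst4 cov A η X Y (endoApply A Z) (endoApply A W) =
      curvatureFirst4 cov A η X Y Z W := by
  rw [curvatureFirst4, h.curvatureFirst_endoApply hη hX hY hZ]
  ext1 x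
  exact h.almostHermitian.isometry x _ _

lemma IsKahler.metric_curvature_endoApply_swap (h : IsKahler cov A)
    (hX : IsSmoothField X) (hY : IsSmoothField Y) (hZ : IsSmoothField Z) (hW : IsSmoothField W)
    (x : M) :
    metric (curvature cov X (endoApply A Y) Z) W x =
      -metric (curvature cov (endoApply A X) Y Z) W x := by
  have hA := h.almostHermitian.smooth
  rw [h.leviCivita.metric_curvature_pair hX (hY.endoApply hA) hZ hW,
    h.leviCivita.metric_curvature_pair (hX.endoApply hA) hY hZ hW,
    curvature_endoApply h.leviCivita.smooth h.parallel hZ hW hX]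
  exact h.almostHermitian.inner_endo_right x _ _

/-- R and dη change sign separately: R by pair symmetry and skew-adjointness of `A`, dη by hybridity
applied to both of its terms. -/
lemma IsKahler.curvatureFirst4_endoApply_swap (h : IsKahler cov A) (hη : IsSmoothOneForm η)
    (hyb : IsHybrid A (nablaOneForm cov η))
    (hX : IsSmoothField X) (hY : IsSmoothField Y) (hZ : IsSmoothField Z) (hW : IsSmoothField W) :
    curvatureFirst4 cov A η X (endoApply A Y) Z W =
      -curvatureFirst4 cov A η (endoApply A X) Y Z W := by
  have hA := h.almostHermitian.smooth
  ext1 x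
  rw [Pi.neg_apply, h.curvatureFirst4_eq hη hX (hY.endoApply hA) hZ,
    h.curvatureFirst4_eq hη (hX.endoApply hA) hY hZ,
    h.metric_curvature_endoApply_swap hX hY hZ hW, hyb X Y hX hY, hyb Y X hY hX]
  ring

end Riemannian

end KahlerQS

end

theorem mainTheorem12 {n : ℕ} {M : Type*} [TopologicalSpace M] [T2Space M]
    [ChartedSpace (EuclideanSpace ℝ (Fin n)) M] [IsManifold (𝓡 n) ∞ M]
    [RiemannianBundle (fun x : M ↦ TangentSpace (𝓡 n) x)]
    [IsContMDiffRiemannianBundle (𝓡 n) ∞ (EuclideanSpace ℝ (Fin n))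
      (fun x : M ↦ TangentSpace (𝓡 n) x)]
    (nablaG : CovariantDerivative (𝓡 n) (EuclideanSpace ℝ (Fin n))
      (TangentSpace (𝓡 n) : M → Type _))
    (A : ∀ x : M, TangentSpace (𝓡 n) x →L[ℝ] TangentSpace (𝓡 n) x)
    (hK : IsKahler nablaG A)
    (η : ∀ x : M, TangentSpace (𝓡 n) x →L[ℝ] ℝ) (hη : IsSmoothOneForm η) :
    (IsHybrid A (nablaOneForm nablaG η) →
      ∀ X Y Z W : ∀ x : M, TangentSpace (𝓡 n) x,
        IsSmoothField X → IsSmoothField Y →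
        IsSmoothField Z → IsSmoothField W →
          curvatureFirst4 nablaG A η X Y (endoApply A Z) (endoApply A W) = curvatureFirst4 nablaG A η (endoApply A X) (endoApply A Y) Z W ∧
          curvatureFirst4 nablaG A η X (endoApply A Y) (endoApply A Z) W = curvatureFirst4 nablaG A η (endoApply A X) Y Z (endoApply A W) ∧
          curvatureFirst4 nablaG A η (endoApply A X) (endoApply A Y) (endoApply A Z) (endoApply A W) = curvatureFirst4 nablaG A η X Y Z W) ∧
    (∀ X Y Z : ∀ x : M, TangentSpace (𝓡 n) x,
        IsSmoothField X → IsSmoothField Y → IsSmoothField Z →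
          curvatureFirst nablaG A η X Y (endoApply A Z) = endoApply A (curvatureFirst nablaG A η X Y Z)) ∧
    (∀ X Y Z W : ∀ x : M, TangentSpace (𝓡 n) x,
        IsSmoothField X → IsSmoothField Y →
        IsSmoothField Z → IsSmoothField W →
          curvatureFirst4 nablaG A η X Y Z (endoApply A W) = - curvatureFirst4 nablaG A η X Y (endoApply A Z) W) := by
  have hA := hK.almostHermitian.smooth
  refine ⟨fun hyb X Y Z W hX hY hZ hW ↦ ⟨?_, ?_, ?_⟩, fun X Y Z hX hY hZ ↦
    hK.curvatureFirst_endoApply hη hX hY hZ, fun X Y Z W hX hY hZ _ ↦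
    hK.curvatureFirst4_endoApply_right hη hX hY hZ⟩
  · rw [hK.curvatureFirst4_endoApply_endoApply hη hX hY hZ,
      hK.curvatureFirst4_endoApply_left hη hyb hX hY hZ hW]
  -- Moving `A` within the first pair and within the last pair each costs a sign, and the two signs
  -- cancel.
  · rw [hK.curvatureFirst4_endoApply_swap hη hyb hX hY (hZ.endoApply hA) hW,
      hK.curvatureFirst4_endoApply_right hη (hX.endoApply hA) hY hZ]
  · rw [hK.curvatureFirst4_endoApply_left hη hyb hX hY (hZ.endoApply hA) (hW.endoApply hA),
      hK.curvatureFirst4_endoApply_endoApply hη hX hY hZ]
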